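/- Let $(X,d)$ be a non-empty metric space with Borel $\sigma$-algebra $\mathcal B$ and let $f\colon X\to X$ be a map. **Notation.** For $n\ge 1$, $\epsilon>0$ let $B_f^n(x,\epsilon)=\{y: d(f^ix,f^iy)<\epsilon,\ 0\le i<n\}$ be the Bowen balls, and for compact $K\subset X$ let $N_{f,K}(\epsilon,n)\in[0,\infty]$ be the minimal number of balls $B^n_f(x,\epsilon)$, $x\in X$, needed to cover $K$. For an $f$-invariant Borel probability measure $\mu$ let $S_{\mathrm{semitop},f}(\epsilon,n)\in[0,\infty]$ be the minimal cardinality of a finite set $F\subset X$ with $\mu\big(\bigcup_{x\in F}B_f^n(x,\epsilon)\big)>1-\epsilon$. For a finite measurable partition $\mathcal P=\{P_1,\dots,P_k\}$ of $X$ write $x_s=j$ if $f^s(x)\in P_j$, let $\bar d^{\,n}_{f,\mathcal P}(x,y)=1-\frac1n\#\{0\le s<n: x_s=y_s\}$ be the Hamming distance, and let $S_{f,\mathcal P}(\epsilon,n)$ be the minimal cardinality of a finite set $F\subset X$ with $\mu\big(\bigcup_{x\in F}\{y:\bar d^{\,n}_{f,\mathcal P}(x,y)<\epsilon\}\big)>1-\epsilon$.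 For the exponential scale $a_\chi(n)=e^{\chi n}$, $\chi\ge 0$, and with $\sup\emptyset=0$, define in $[0,\infty]$ the topological, metric and semi-topological slow entropies $$h_{\mathrm{top},a_\chi}(f)=\sup_{K}\lim_{\epsilon\to0}\sup\Big\{\chi\ge 0:\limsup_{n\to\infty}\tfrac{N_{f,K}(\epsilon,n)}{a_\chi(n)}>0\Big\},$$ $$h_{\mu,a_\chi}(f)=\sup_{\mathcal P}\lim_{\epsilon\to0}\sup\Big\{\chi\ge 0:\limsup_{n\to\infty}\tfrac{S_{f,\mathcal P}(\epsilon,n)}{a_\chi(n)}>0\Big\},$$ $$h_{\mathrm{semitop},\mu,a_\chi}(f)=\limsup_{\epsilon\to0}\,\sup\Big\{\chi\ge 0:\limsup_{n\to\infty}\tfrac{S_{\mathrm{semitop},f}(\epsilon,n)}{a_\chi(n)}>0\Big\},$$ where $K$ ranges over the compact subsets and $\mathcal P$ over the finite measurable partitions of $X$. The classical entropies are $$h_{\mathrm{top}}(f)=\sup_K\lim_{\epsilon\to0}\limsup_{n\to\infty}\frac{\log N_{f,K}(\epsilon,n)}{n},\qquad h_\mu(f)=\sup_{\mathcal P}\lim_{n\to\infty}\frac1n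 H_\mu\Big(\bigvee_{i=0}^{n-1}f^{-i}\mathcal P\Big),$$ with $H_\mu(\mathcal Q)=-\sum_{Q\in\mathcal Q}\mu(Q)\log\mu(Q)$. **Theorem.** For every Borel probability measure $\mu$ on $X$ such that $f$ is measurable, $\mu$-preserving and ergodic, $$h_{\mu,a_\chi}(f)=h_\mu(f),$$ and if $\mu$ gives full measure to some totally bounded subset of $X$ (in particular, whenever $X$ is compact), then also $$h_{\mathrm{semitop},\mu,a_\chi}(f)=h_\mu(f).$$ Moreover $$h_{\mathrm{top},a_\chi}(f)=h_{\mathrm{top}}(f).$$ -/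

import Mathlib

open Set Filter Topology MeasureTheory
open scoped NNReal ENNReal

noncomputable section

namespace SlowEntropy

/-- A scale: a family of nondecreasing positive functions of the positive integers, indexed by
`χ ≥ 0`, such that `a χ = o(a χ')` whenever `χ < χ'`. The value at `n = 0` is irrelevant. -/
structure Scale where
  /-- The functions of the family. -/
  toFun : ℝ≥0 → ℕ → ℝ
  pos : ∀ χ n, 0 < n → 0 < toFun χ n
  mono : ∀ χ, MonotoneOn (toFun χ) (Ici 1)
  isLittleO : ∀ χ χ', χ < χ' → Asymptotics.IsLittleO atTop (toFun χ) (toFun χ')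

/-- The exponential scale `a χ n = exp (χ n)`. -/
def expScale : Scale where
  toFun χ n := Real.exp ((χ : ℝ) * n)
  pos _ _ _ := Real.exp_pos _
  mono χ := fun m _ n _ hmn => Real.exp_le_exp.2
    (mul_le_mul_of_nonneg_left (Nat.cast_le.2 hmn) χ.2)
  isLittleO χ χ' h := by
    rw [Real.isLittleO_exp_comp_exp_comp]
    have h1 : (0 : ℝ) < (χ' : ℝ) - χ := sub_pos.2 (by exact_mod_cast h)
    have h2 := (tendsto_natCast_atTop_atTop (R := ℝ)).const_mul_atTop h1
    refine h2.congr fun n => ?_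
    ring

/-- `sup {χ ≥ 0 : limsup_n N n / a χ n > 0}`, in `[0, ∞]`; the supremum of the empty set is `0`. -/
def growth (a : Scale) (N : ℕ → ℕ∞) : ℝ≥0∞ :=
  ⨆ (χ : ℝ≥0)
    (_ : 0 < limsup (fun n : ℕ => ((N n : ℕ∞) : ℝ≥0∞) / ENNReal.ofReal (a.toFun χ n)) atTop),
    (χ : ℝ≥0∞)

section Topological

variable {X : Type*} [MetricSpace X]

/-- The Bowen ball: all `y` with `d (f^i x) (f^i y) < ε` for `0 ≤ i < n`. -/
def bowenBall (f : X → X) (n : ℕ) (x : X) (ε : ℝ) : Set X :=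
  {y | ∀ i < n, f^[i] y ∈ Metric.ball (f^[i] x) ε}

/-- The minimal number of `(ε, n)`-Bowen balls that cover `K` (`⊤` if there is no finite cover). -/
def bowenCoverNumber (f : X → X) (K : Set X) (ε : ℝ) (n : ℕ) : ℕ∞ :=
  ⨅ (F : Finset X) (_ : K ⊆ ⋃ x ∈ F, bowenBall f n x ε), (F.card : ℕ∞)

/-- The topological slow entropy. The inner quantity is monotone in `ε`, so that its upper limit
as `ε → 0⁺` is a limit (`tendsto_growth_bowenCoverNumber`). -/
def topSlowEntropy (a : Scale) (f : X → X) : ℝ≥0∞ :=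
  ⨆ (K : Set X) (_ : IsCompact K),
    limsup (fun ε : ℝ => growth a (bowenCoverNumber f K ε)) (𝓝[>] 0)

/-- The exponential growth rate `limsup_n (1 / n) log N n` as an extended real number. -/
def expRate (N : ℕ → ℕ∞) : EReal :=
  limsup (fun n : ℕ => ENNReal.log ((N n : ℕ∞) : ℝ≥0∞) / (n : EReal)) atTop

/-- The classical topological entropy. The inner quantity is monotone in `ε`, so that its upper
limit as `ε → 0⁺` is a limit (`tendsto_expRate_bowenCoverNumber`). -/
def topEntropy (f : X → X) : EReal :=
  ⨆ (K : Set X) (_ : IsCompact K),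
    limsup (fun ε : ℝ => expRate (bowenCoverNumber f K ε)) (𝓝[>] 0)

end Topological

section Metric

variable {X : Type*} [MeasurableSpace X]

/- A finite measurable partition of `X` into `k` atoms is given by its labelling, a measurable map
`P : X → Fin k`; the atoms are the sets `P ⁻¹' {j}` (some of which may be empty). -/

/-- The Hamming distance of the codings of `x` and `y` up to time `n`. -/
def hammingDistance {k : ℕ} (f : X → X) (P : X → Fin k) (n : ℕ) (x y : X) : ℝ :=
  1 - (((Finset.range n).filter fun s => P (f^[s] x) = P (f^[s] y)).card : ℝ) / n

/-- The `(ε, n)`-Hamming ball. -/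
def hammingBall {k : ℕ} (f : X → X) (P : X → Fin k) (n : ℕ) (x : X) (ε : ℝ) : Set X :=
  {y | hammingDistance f P n x y < ε}

/-- The minimal number of `(ε, n)`-Hamming balls whose union has measure larger than `1 - ε`. -/
def hammingCoverNumber {k : ℕ} (μ : Measure X) (f : X → X) (P : X → Fin k) (ε : ℝ) (n : ℕ) : ℕ∞ :=
  ⨅ (F : Finset X) (_ : 1 - ε < μ.real (⋃ x ∈ F, hammingBall f P n x ε)), (F.card : ℕ∞)

/-- The metric slow entropy with respect to a partition. The inner quantity is monotone in `ε`, so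
that its upper limit as `ε → 0⁺` is a limit (`tendsto_growth_hammingCoverNumber`). -/
def metricSlowEntropyOf {k : ℕ} (a : Scale) (μ : Measure X) (f : X → X) (P : X → Fin k) : ℝ≥0∞ :=
  limsup (fun ε : ℝ => growth a (hammingCoverNumber μ f P ε)) (𝓝[>] 0)

/-- The metric slow entropy: the supremum over all finite measurable partitions. -/
def metricSlowEntropy (a : Scale) (μ : Measure X) (f : X → X) : ℝ≥0∞ :=
  ⨆ (k : ℕ) (P : X → Fin k) (_ : Measurable P), metricSlowEntropyOf a μ f P

/-- The Shannon entropy `∑ -μ(Q_a) log μ(Q_a)` of the partition into the fibres of `Q`. -/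
def shannonEntropy {ι : Type*} [Fintype ι] (μ : Measure X) (Q : X → ι) : ℝ :=
  ∑ a, Real.negMulLog (μ.real (Q ⁻¹' {a}))

/-- The labelling of the joint partition `P ∨ f⁻¹ P ∨ ⋯ ∨ f⁻⁽ⁿ⁻¹⁾ P`. -/
def iteratedJoin {k : ℕ} (f : X → X) (P : X → Fin k) (n : ℕ) (x : X) : Fin n → Fin k :=
  fun i => P (f^[(i : ℕ)] x)

/-- The entropy of `f` with respect to a partition, `lim_n (1 / n) H(P ∨ ⋯ ∨ f⁻⁽ⁿ⁻¹⁾ P)`; for an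
invariant probability measure the sequence converges by subadditivity, and the upper limit is the
limit. -/
def ksEntropyOf {k : ℕ} (μ : Measure X) (f : X → X) (P : X → Fin k) : EReal :=
  limsup (fun n : ℕ => ((shannonEntropy μ (iteratedJoin f P n) / n : ℝ) : EReal)) atTop

/-- The Kolmogorov–Sinai entropy: the supremum over all finite measurable partitions. -/
def ksEntropy (μ : Measure X) (f : X → X) : EReal :=
  ⨆ (k : ℕ) (P : X → Fin k) (_ : Measurable P), ksEntropyOf μ f P

end Metric

section SemiTopological

variable {X : Type*} [MetricSpace X] [MeasurableSpace X]

/-- The minimal number of `(ε, n)`-Bowen balls whose union has measure larger than `1 - ε`. -/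
def semiTopCoverNumber (μ : Measure X) (f : X → X) (ε : ℝ) (n : ℕ) : ℕ∞ :=
  ⨅ (F : Finset X) (_ : 1 - ε < μ.real (⋃ x ∈ F, bowenBall f n x ε)), (F.card : ℕ∞)

/-- The semi-topological slow entropy. -/
def semiTopSlowEntropy (a : Scale) (μ : Measure X) (f : X → X) : ℝ≥0∞ :=
  limsup (fun ε : ℝ => growth a (semiTopCoverNumber μ f ε)) (𝓝[>] 0)

end SemiTopological

section Limits

theorem growth_mono (a : Scale) {N M : ℕ → ℕ∞} (h : N ≤ M) : growth a N ≤ growth a M :=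
  iSup_mono fun _ => iSup_mono' fun hχ => ⟨hχ.trans_le (limsup_le_limsup
    (Eventually.of_forall fun n => ENNReal.div_le_div_right (ENat.toENNReal_mono (h n)) _)),
    le_rfl⟩

theorem expRate_mono {N M : ℕ → ℕ∞} (h : N ≤ M) : expRate N ≤ expRate M :=
  limsup_le_limsup (Eventually.of_forall fun n => EReal.div_le_div_right_of_nonneg
    (by positivity) (ENNReal.log_monotone (ENat.toENNReal_mono (h n))))

theorem bowenBall_mono {X : Type*} [MetricSpace X] (f : X → X) (n : ℕ) (x : X) {ε δ : ℝ}
    (h : ε ≤ δ) : bowenBall f n x ε ⊆ bowenBall f n x δ :=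
  fun _ hy i hi => Metric.ball_subset_ball h (hy i hi)

theorem bowenCoverNumber_antitone {X : Type*} [MetricSpace X] (f : X → X) (K : Set X) :
    Antitone (bowenCoverNumber f K) := fun _ _ h n =>
  iInf_mono fun _ => iInf_mono' fun hF =>
    ⟨hF.trans (iUnion₂_mono fun x _ => bowenBall_mono f n x h), le_rfl⟩

theorem hammingCoverNumber_antitone {X : Type*} [MeasurableSpace X] {k : ℕ} (μ : Measure X)
    [IsProbabilityMeasure μ] (f : X → X) (P : X → Fin k) :
    Antitone (hammingCoverNumber μ f P) := fun _ _ h _ =>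
  iInf_mono fun _ => iInf_mono' fun hF =>
    ⟨(sub_le_sub_left h 1).trans_lt (hF.trans_le (measureReal_mono
      (iUnion₂_mono fun _ _ _ hy => lt_of_lt_of_le hy h) (measure_ne_top μ _))), le_rfl⟩

theorem tendsto_limsup_of_antitone {β : Type*} [CompleteLinearOrder β] [TopologicalSpace β]
    [OrderTopology β] {g : ℝ → β} (hg : Antitone g) :
    Tendsto g (𝓝[>] 0) (𝓝 (limsup g (𝓝[>] 0))) := by
  have h := hg.tendsto_nhdsGT 0
  rwa [h.limsup_eq]

theorem tendsto_growth_bowenCoverNumber {X : Type*} [MetricSpace X] (a : Scale) (f : X → X)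
    (K : Set X) :
    Tendsto (fun ε : ℝ => growth a (bowenCoverNumber f K ε)) (𝓝[>] 0)
      (𝓝 (limsup (fun ε : ℝ => growth a (bowenCoverNumber f K ε)) (𝓝[>] 0))) :=
  tendsto_limsup_of_antitone fun _ _ h => growth_mono a (bowenCoverNumber_antitone f K h)

theorem tendsto_expRate_bowenCoverNumber {X : Type*} [MetricSpace X] (f : X → X) (K : Set X) :
    Tendsto (fun ε : ℝ => expRate (bowenCoverNumber f K ε)) (𝓝[>] 0)
      (𝓝 (limsup (fun ε : ℝ => expRate (bowenCoverNumber f K ε)) (𝓝[>] 0))) :=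
  tendsto_limsup_of_antitone fun _ _ h => expRate_mono (bowenCoverNumber_antitone f K h)

theorem tendsto_growth_hammingCoverNumber {X : Type*} [MeasurableSpace X] {k : ℕ} (a : Scale)
    (μ : Measure X) [IsProbabilityMeasure μ] (f : X → X) (P : X → Fin k) :
    Tendsto (fun ε : ℝ => growth a (hammingCoverNumber μ f P ε)) (𝓝[>] 0)
      (𝓝 (metricSlowEntropyOf a μ f P)) :=
  tendsto_limsup_of_antitone fun _ _ h => growth_mono a (hammingCoverNumber_antitone μ f P h)

end Limits

end SlowEntropy

end

namespace SlowEntropy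

/-! For the exponential scale, `growth` is the usual exponential growth rate as soon as the counts
are at least `1` (`growth_expScale_eq_expRate`). This settles the topological case compact set by
compact set, the empty one apart.

The metric case compares Hamming cover numbers with Shannon entropy. Above: the mean ergodic
theorem, applied to the information of `m`-blocks, shows that most points have names whose blocks
carry little information on average, and such names are few because block probabilities sum to `1`
(`eventually_exists_words`). The Shannon–McMillan–Breiman theorem is thus avoided. Below: a
Fano-type inequality (`shannonEntropy_iteratedJoin_le`) encodes a name as one of the ball centres
plus a small number of errors, so few balls force small entropy; ergodicity plays no role here.

In the semi-topological case, a totally bounded set of full measure gives a partition into small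
atoms, so that equal names imply Bowen closeness (`semiTopSlowEntropy_expScale_le`). Conversely,
atoms become separated after a small set is removed, and by invariance most orbits rarely visit that
set; hence Bowen closeness implies Hamming closeness (`eventually_hammingCoverNumber_le`). -/

/-! ### Exponential growth rates and topological entropy -/

theorem ofReal_le_growth_expScale {N : ℕ → ℕ∞} {c C : ℝ} (hc : 0 ≤ c) (hC : 0 < C)
    (h : ∃ᶠ n : ℕ in atTop, ENNReal.ofReal (C * Real.exp (c * n)) ≤ N n) :
    ENNReal.ofReal c ≤ growth expScale N := by
  refine le_iSup₂_of_le c.toNNReal ?_ le_rfl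
  refine (ENNReal.ofReal_pos.2 hC).trans_le (le_limsup_of_frequently_le (h.mono fun n hn => ?_))
  have he : (expScale.toFun c.toNNReal n) = Real.exp (c * n) := by
    simp [expScale, hc]
  rw [he, ENNReal.le_div_iff_mul_le (Or.inl (by simpa using Real.exp_pos _)) (Or.inl (by simp)),
    ← ENNReal.ofReal_mul hC.le]
  exact hn

theorem growth_expScale_le {N : ℕ → ℕ∞} {c C : ℝ} (hc : 0 ≤ c)
    (h : ∀ᶠ n : ℕ in atTop, (N n : ℝ≥0∞) ≤ ENNReal.ofReal (C * Real.exp (c * n))) :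
    growth expScale N ≤ ENNReal.ofReal c := by
  refine iSup₂_le fun χ hχ => ?_
  by_contra! hlt
  have hlt' : c < χ := by
    rwa [← ENNReal.ofReal_coe_nnreal, ENNReal.ofReal_lt_ofReal_iff_of_nonneg hc] at hlt
  refine hχ.ne' (le_antisymm ?_ zero_le)
  have ht : Tendsto (fun n : ℕ => ENNReal.ofReal (C * Real.exp (-((χ - c) * n)))) atTop (𝓝 0) := by
    rw [← ENNReal.ofReal_zero, ← mul_zero C]
    refine ENNReal.tendsto_ofReal
      (Tendsto.const_mul _ (Real.tendsto_exp_neg_atTop_nhds_zero.comp ?_))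
    exact tendsto_natCast_atTop_atTop.const_mul_atTop (sub_pos.2 hlt')
  rw [← ht.limsup_eq]
  refine limsup_le_limsup (h.mono fun n hn => ?_)
  rw [ENNReal.div_le_iff_le_mul (Or.inl (by simpa [expScale] using Real.exp_pos _))
    (Or.inl (by simp)), ← ENNReal.ofReal_mul' (by simpa [expScale] using (Real.exp_pos _).le)]
  refine hn.trans (ENNReal.ofReal_le_ofReal (le_of_eq ?_))
  simp only [expScale]
  rw [mul_assoc, ← Real.exp_add]
  ring_nf

/-- The bound `1 ≤ N n` matters: for vanishing counts the left side is `0`, while `ENNReal.log 0 =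
⊥` makes the right side `⊥`. -/
theorem growth_expScale_eq_expRate {N : ℕ → ℕ∞} (hN : ∀ n, 1 ≤ N n) :
    (growth expScale N : EReal) = expRate N := by
  have key : ∀ (c : ℝ) (n : ℕ),
      ENNReal.log (ENNReal.ofReal (Real.exp (c * n))) = (c : EReal) * n := by
    intro c n
    rw [ENNReal.log_ofReal_of_pos (Real.exp_pos _), Real.log_exp]
    simp
  apply le_antisymm
  · refine EReal.le_of_forall_lt_iff_le.1 fun c hc => ?_
    have hev := eventually_lt_of_limsup_lt hc
    have hc0 : 0 ≤ c := by
      obtain ⟨n, hn⟩ := hev.exists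
      have : (0 : EReal) ≤ ENNReal.log (N n : ℝ≥0∞) / (n : EReal) :=
        EReal.div_nonneg (ENNReal.zero_le_log_iff.2 (by exact_mod_cast hN n)) (by positivity)
      exact_mod_cast (this.trans_lt hn).le
    have := growth_expScale_le (N := N) (C := 1) hc0 ?_
    · rw [← max_eq_left hc0, ← EReal.coe_ennreal_ofReal]
      exact_mod_cast this
    · filter_upwards [hev, eventually_gt_atTop 0] with n hn hn0
      rw [one_mul, ← ENNReal.log_le_log_iff, key]
      exact ((EReal.div_le_iff_le_mul (by exact_mod_cast hn0) (EReal.natCast_ne_top n)).1 hn.le).trans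
        (mul_comm _ _).le
  · refine EReal.ge_of_forall_gt_iff_ge.1 fun c hc => ?_
    rcases lt_or_ge c 0 with h0 | h0
    · exact (EReal.coe_le_coe_iff.2 h0.le).trans (EReal.coe_ennreal_nonneg _)
    have := ofReal_le_growth_expScale (N := N) (C := 1) h0 one_pos ?_
    · rw [← max_eq_left h0, ← EReal.coe_ennreal_ofReal]
      exact_mod_cast this
    · refine ((frequently_lt_of_lt_limsup (by isBoundedDefault) hc).and_eventually
        (eventually_gt_atTop 0)).mono fun n ⟨hn, hn0⟩ => ?_
      rw [one_mul, ← ENNReal.log_le_log_iff, key]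
      exact (EReal.le_div_iff_mul_le (by exact_mod_cast hn0) (EReal.natCast_ne_top n)).1 hn.le

theorem one_le_bowenCoverNumber {X : Type*} [MetricSpace X] (f : X → X) {K : Set X}
    (hK : K.Nonempty) (ε : ℝ) (n : ℕ) : 1 ≤ bowenCoverNumber f K ε n := by
  refine le_iInf₂ fun F hF => ?_
  obtain ⟨x, hx⟩ := hK
  obtain ⟨y, hy, -⟩ := mem_iUnion₂.1 (hF hx)
  exact_mod_cast Finset.card_pos.2 ⟨y, hy⟩

theorem coe_ennreal_limsup {ι : Type*} {l : Filter ι} [l.NeBot] (u : ι → ℝ≥0∞) :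
    ((limsup u l : ℝ≥0∞) : EReal) = limsup (fun i => (u i : EReal)) l :=
  Monotone.map_limsup_of_continuousAt (fun _ _ h => EReal.coe_ennreal_le_coe_ennreal_iff.2 h) u
    continuous_coe_ennreal_ereal.continuousAt

theorem limsup_growth_bowenCoverNumber {X : Type*} [MetricSpace X] (f : X → X) {K : Set X}
    (hK : K.Nonempty) :
    ((limsup (fun ε : ℝ => growth expScale (bowenCoverNumber f K ε)) (𝓝[>] 0) : ℝ≥0∞) : EReal) =
      limsup (fun ε : ℝ => expRate (bowenCoverNumber f K ε)) (𝓝[>] 0) := by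
  rw [coe_ennreal_limsup]
  simp only [growth_expScale_eq_expRate (one_le_bowenCoverNumber f hK _)]

theorem coe_ennreal_iSup₂_le {ι : Sort*} {p : ι → Prop} {g : ι → ℝ≥0∞} {b : EReal} (hb : 0 ≤ b)
    (h : ∀ i, p i → (g i : EReal) ≤ b) : ((⨆ (i) (_ : p i), g i : ℝ≥0∞) : EReal) ≤ b := by
  lift b to ℝ≥0∞ using hb
  exact_mod_cast iSup₂_le fun i hi => EReal.coe_ennreal_le_coe_ennreal_iff.1 (h i hi)

theorem topEntropy_nonneg {X : Type*} [MetricSpace X] [Nonempty X] (f : X → X) :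
    0 ≤ topEntropy f := by
  obtain ⟨x⟩ := ‹Nonempty X›
  refine le_iSup₂_of_le {x} isCompact_singleton ?_
  rw [← limsup_growth_bowenCoverNumber f (singleton_nonempty x)]
  exact EReal.coe_ennreal_nonneg _

theorem topSlowEntropy_expScale {X : Type*} [MetricSpace X] [Nonempty X] (f : X → X) :
    (topSlowEntropy expScale f : EReal) = topEntropy f := by
  apply le_antisymm
  · refine coe_ennreal_iSup₂_le (topEntropy_nonneg f) fun K hK => ?_
    rcases K.eq_empty_or_nonempty with rfl | hne
    · have h0 : ∀ (ε : ℝ), growth expScale (bowenCoverNumber f ∅ ε) = 0 := by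
        intro ε
        have : ∀ n, bowenCoverNumber f ∅ ε n = 0 := fun n =>
          le_antisymm (iInf₂_le_of_le ∅ (empty_subset _) (by simp)) zero_le
        simp [growth, this]
      simpa [h0] using topEntropy_nonneg f
    · rw [limsup_growth_bowenCoverNumber f hne]
      exact le_iSup₂_of_le K hK le_rfl
  · refine iSup₂_le fun K hK => ?_
    rcases K.eq_empty_or_nonempty with rfl | hne
    -- The empty compact set has rate `⊥`, which no slow growth equals; it is dominated by a
    -- singleton.
    · obtain ⟨x⟩ := ‹Nonempty X›
      refine le_trans (limsup_le_limsup (v := fun ε : ℝ => expRate (bowenCoverNumber f {x} ε))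
        (Eventually.of_forall fun ε => expRate_mono fun n => ?_)) ?_
      · exact iInf₂_le_of_le ∅ (empty_subset _) (by simp)
      · rw [← limsup_growth_bowenCoverNumber f (singleton_nonempty x)]
        exact EReal.coe_ennreal_le_coe_ennreal_iff.2
          (le_iSup₂_of_le {x} isCompact_singleton le_rfl)
    · rw [← limsup_growth_bowenCoverNumber f hne]
      exact EReal.coe_ennreal_le_coe_ennreal_iff.2 (le_iSup₂_of_le K hK le_rfl)

/-! ### The mean ergodic theorem -/

theorem coeFn_birkhoffAverage_compMeasurePreserving {Ω : Type*} [MeasurableSpace Ω] {μ : Measure Ω}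
    {f : Ω → Ω} (hf : MeasurePreserving f μ μ) {p : ℝ≥0∞} {g : Ω → ℝ} (hg : MemLp g p μ) (n : ℕ) :
    (birkhoffAverage ℝ (Lp.compMeasurePreserving f hf) id n (hg.toLp g) : Lp ℝ p μ) =ᵐ[μ]
      birkhoffAverage ℝ f g n := by
  have hsum : (birkhoffSum (Lp.compMeasurePreserving f hf) id n (hg.toLp g) : Lp ℝ p μ) =ᵐ[μ]
      birkhoffSum f g n := by
    induction n with
    | zero => simpa [birkhoffSum_zero] using Lp.coeFn_zero ℝ p μ
    | succ n ih =>
      have h1 := Lp.coeFn_add (birkhoffSum (Lp.compMeasurePreserving f hf) id n (hg.toLp g))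
        ((Lp.compMeasurePreserving f hf)^[n] (hg.toLp g))
      have h2 : (Lp.compMeasurePreserving f hf)^[n] (hg.toLp g) =ᵐ[μ] g ∘ f^[n] := by
        rw [Lp.compMeasurePreserving_iterate, Lp.toLp_compMeasurePreserving]
        exact MemLp.coeFn_toLp _
      simp only [birkhoffSum_succ, id]
      filter_upwards [h1, h2, ih] with x h1 h2 h3
      rw [h1, Pi.add_apply, h2, h3, birkhoffSum_succ]
      rfl
  have h1 := Lp.coeFn_smul (n⁻¹ : ℝ) (birkhoffSum (Lp.compMeasurePreserving f hf) id n (hg.toLp g))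
  filter_upwards [h1, hsum] with x h1 h2
  rw [birkhoffAverage, h1, Pi.smul_apply, h2]
  rfl

/-- The mean ergodic theorem for an ergodic map, as convergence in measure. -/
theorem tendstoInMeasure_birkhoffAverage {Ω : Type*} [MeasurableSpace Ω] {μ : Measure Ω}
    [IsProbabilityMeasure μ] {f : Ω → Ω} (hf : Ergodic f μ) {g : Ω → ℝ} (hg : MemLp g 2 μ) :
    TendstoInMeasure μ (fun n => birkhoffAverage ℝ f g n) atTop fun _ => ∫ x, g x ∂μ := by
  set U : Lp ℝ 2 μ →L[ℝ] Lp ℝ 2 μ :=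
    (Lp.compMeasurePreservingₗᵢ ℝ f hf.toMeasurePreserving).toContinuousLinearMap with hU
  have hUapp : ∀ y, U y = Lp.compMeasurePreserving f hf.toMeasurePreserving y := fun _ => rfl
  set G := hg.toLp g
  set K := U.eqLocus (1 : Lp ℝ 2 μ →L[ℝ] Lp ℝ 2 μ)
  set y : Lp ℝ 2 μ := K.starProjection G with hy
  have hlim : Tendsto (fun n => birkhoffAverage ℝ U id n G) atTop (𝓝 y) :=
    U.tendsto_birkhoffAverage_orthogonalProjection
      (LinearIsometry.norm_toContinuousLinearMap_le _) G
  have hyK : U y = y := (K.orthogonalProjectionOnto G).2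
  -- The limit is the projection of `G` onto the vectors fixed by the Koopman operator; by
  -- ergodicity these are the constants.
  have hconst : ∃ c, y =ᵐ[μ] Function.const Ω c := by
    refine hf.ae_eq_const_of_ae_eq_comp_ae (Lp.aestronglyMeasurable y) ?_
    have := Lp.coeFn_compMeasurePreserving y hf.toMeasurePreserving
    rw [← hUapp, hyK] at this
    exact this.symm
  obtain ⟨c, hc⟩ := hconst
  have hone : MemLp (fun _ : Ω => (1 : ℝ)) 2 μ := memLp_const 1
  -- Orthogonality of `G - y` to the fixed vector `1` identifies the constant as the integral.
  have hinner : inner ℝ (G - y) (hone.toLp _) = 0 :=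
    K.starProjection_inner_eq_zero G _ (show U (hone.toLp _) = _ from rfl)
  have hgi : Integrable g μ := hg.integrable (by norm_num)
  have hceq : ∫ x, g x ∂μ = c := by
    rw [L2.inner_def] at hinner
    have : ∫ x, (g x - c) ∂μ = 0 := by
      rw [← hinner]
      refine integral_congr_ae ?_
      filter_upwards [Lp.coeFn_sub G y, hg.coeFn_toLp, hone.coeFn_toLp, hc] with x h1 h2 h3 h4
      rw [h1, Pi.sub_apply, h2, h3, h4]
      simp
    rw [integral_sub hgi (integrable_const c)] at this
    simpa [sub_eq_zero] using this
  rw [hceq]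
  exact (tendstoInMeasure_of_tendsto_Lp hlim).congr
    (fun n => coeFn_birkhoffAverage_compMeasurePreserving hf.toMeasurePreserving hg n) hc

/-! ### Upper bound: counting names of low information -/

/-- The product weights of all words of length `L` add up to `(∑ v, p v) ^ L ≤ 1`, and each word of
`B` takes at least `exp (-T)` of this mass. -/
theorem card_le_exp_of_le_prod {V : Type*} [Fintype V] {p : V → ℝ} (hp : ∀ v, 0 ≤ p v)
    (hsum : ∑ v, p v ≤ 1) {L : ℕ} {T : ℝ} {B : Finset (Fin L → V)}
    (hB : ∀ b ∈ B, Real.exp (-T) ≤ ∏ l, p (b l)) : (B.card : ℝ) ≤ Real.exp T := by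
  have h1 : (B.card : ℝ) * Real.exp (-T) ≤ 1 := calc
    _ = ∑ b ∈ B, Real.exp (-T) := by simp
    _ ≤ ∑ b ∈ B, ∏ l, p (b l) := Finset.sum_le_sum hB
    _ ≤ ∑ b : Fin L → V, ∏ l, p (b l) := Finset.sum_le_sum_of_subset_of_nonneg
      (Finset.subset_univ _) fun b _ _ => Finset.prod_nonneg fun l _ => hp _
    _ = (∑ v, p v) ^ L := (Fintype.sum_pow p L).symm
    _ ≤ 1 := pow_le_one₀ (Finset.sum_nonneg fun v _ => hp v) hsum
  rw [Real.exp_neg] at h1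
  exact (mul_inv_le_iff₀ (Real.exp_pos T)).1 h1 |>.trans_eq (one_mul _)

theorem sum_range_sum_range_add_mul (a : ℕ → ℝ) (m L : ℕ) :
    ∑ j ∈ Finset.range m, ∑ l ∈ Finset.range L, a (j + m * l) = ∑ i ∈ Finset.range (m * L), a i := by
  rw [Finset.sum_comm]
  induction L with
  | zero => simp
  | succ L ih =>
    rw [Finset.sum_range_succ, ih, mul_add_one, Finset.sum_range_add]
    simp only [add_comm]

section

variable {X : Type*} [MeasurableSpace X]

theorem measurable_iteratedJoin {k : ℕ} {f : X → X} (hf : Measurable f) {P : X → Fin k}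
    (hP : Measurable P) (n : ℕ) : Measurable (iteratedJoin f P n) :=
  measurable_pi_lambda _ fun i => hP.comp (hf.iterate i)

theorem sum_measureReal_fibre {ι : Type*} [Fintype ι] [MeasurableSpace ι]
    [MeasurableSingletonClass ι] (μ : Measure X) [IsProbabilityMeasure μ] {Q : X → ι}
    (hQ : Measurable Q) : ∑ a, μ.real (Q ⁻¹' {a}) = 1 := by
  simpa using sum_measureReal_preimage_singleton (μ := μ) (f := Q) Finset.univ
    fun a _ => hQ (measurableSet_singleton a)

theorem integral_comp_eq_sum_fibre {ι : Type*} [Fintype ι] [MeasurableSpace ι]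
    [MeasurableSingletonClass ι] (μ : Measure X) [IsProbabilityMeasure μ] {Q : X → ι}
    (hQ : Measurable Q) (φ : ι → ℝ) : ∫ x, φ (Q x) ∂μ = ∑ a, μ.real (Q ⁻¹' {a}) * φ a := by
  have := Measure.isProbabilityMeasure_map (μ := μ) hQ.aemeasurable
  rw [← integral_map (φ := Q) hQ.aemeasurable (f := φ)
    (measurable_of_finite φ).aestronglyMeasurable, integral_fintype .of_finite]
  simp [map_measureReal_apply hQ (measurableSet_singleton _)]

/-- Needed because `Real.log 0 = 0` would assign zero information to null atoms and spoil the
counting. -/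
theorem ae_measureReal_fibre_pos {ι : Type*} [Countable ι] (μ : Measure X)
    [IsProbabilityMeasure μ] (Q : X → ι) : ∀ᵐ x ∂μ, 0 < μ.real (Q ⁻¹' {Q x}) := by
  have : ∀ a, ∀ᵐ x ∂μ, Q x = a → 0 < μ.real (Q ⁻¹' {a}) := by
    intro a
    rcases measureReal_nonneg.eq_or_lt (a := (0 : ℝ)) (b := μ.real (Q ⁻¹' {a})) with h | h
    · have h0 : μ (Q ⁻¹' {a}) = 0 := (measureReal_eq_zero_iff).1 h.symm
      filter_upwards [measure_eq_zero_iff_ae_notMem.1 h0] with x hx hxa using absurd hxa hx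
    · exact Eventually.of_forall fun _ _ => h
  filter_upwards [ae_all_iff.2 this] with x hx using hx _ rfl

/-- Words of length `n` along which the average information of the `m`-blocks is small are few. -/
theorem card_words_le [Nonempty X] {k m n : ℕ} {μ : Measure X} [IsProbabilityMeasure μ] {f : X → X}
    (hf : Measurable f) {P : X → Fin k} (hP : Measurable P) (hm : 0 < m) (hmn : 2 * m ≤ n) {T : ℝ}
    {W : Finset (Fin n → Fin k)}
    (hW : ∀ w ∈ W, ∃ x, iteratedJoin f P n x = w ∧
      (∀ i, 0 < μ.real (iteratedJoin f P m ⁻¹' {iteratedJoin f P m (f^[i] x)})) ∧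
      ∑ i ∈ Finset.range n,
        -Real.log (μ.real (iteratedJoin f P m ⁻¹' {iteratedJoin f P m (f^[i] x)})) ≤ m * T) :
    (W.card : ℝ) ≤ m * (Real.exp T * ((k : ℝ) ^ m * (k : ℝ) ^ (2 * m))) := by
  classical
  set p : (Fin m → Fin k) → ℝ := fun v => μ.real (iteratedJoin f P m ⁻¹' {v}) with hp
  choose! r hr hpos hT using hW
  -- With this `L`, for every offset `j < m` the `L` consecutive `m`-blocks from `j` on fit into
  -- `[0, n)` and leave fewer than `2 * m` letters at the end.
  set L := n / m - 1 with hL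
  have hLn : m * L + m ≤ n ∧ n < m * L + 2 * m := by
    have h1 : 2 ≤ n / m := (Nat.le_div_iff_mul_le hm).2 hmn
    have h2 := Nat.div_add_mod n m
    have h3 := Nat.mod_lt n hm
    obtain ⟨q, hq⟩ : ∃ q, n / m = q + 1 := ⟨n / m - 1, by omega⟩
    rw [hq, Nat.mul_add, mul_one] at h2
    rw [hL, hq, Nat.add_sub_cancel]
    omega
  set S : ℕ → Finset (Fin n → Fin k) := fun j => W.filter fun w =>
    ∑ l ∈ Finset.range L, -Real.log (p (iteratedJoin f P m (f^[j + m * l] (r w)))) ≤ T with hS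
  -- The information over all positions is at most `m * T`, and positions split by offset into `m`
  -- families of disjoint blocks; some offset has total at most `T`.
  have hcover : W ⊆ (Finset.range m).biUnion S := by
    intro w hw
    have hle : ∑ j ∈ Finset.range m, ∑ l ∈ Finset.range L,
        -Real.log (p (iteratedJoin f P m (f^[j + m * l] (r w)))) ≤ ∑ j ∈ Finset.range m, T := by
      rw [sum_range_sum_range_add_mul
        (fun i => -Real.log (p (iteratedJoin f P m (f^[i] (r w)))))]
      refine (Finset.sum_le_sum_of_subset_of_nonneg ?_ fun i _ _ => ?_).trans
        ((hT w hw).trans_eq (by simp))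
      · exact Finset.range_mono (by omega)
      · exact neg_nonneg.2 (Real.log_nonpos measureReal_nonneg measureReal_le_one)
    obtain ⟨j, hj, hjT⟩ := Finset.exists_le_of_sum_le (Finset.nonempty_range_iff.2 hm.ne') hle
    exact Finset.mem_biUnion.2 ⟨j, hj, Finset.mem_filter.2 ⟨hw, hjT⟩⟩
  set B : Finset (Fin L → Fin m → Fin k) :=
    Finset.univ.filter fun b => Real.exp (-T) ≤ ∏ l, p (b l) with hB
  have hBcard : (B.card : ℝ) ≤ Real.exp T :=
    card_le_exp_of_le_prod (p := p) (fun _ => measureReal_nonneg)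
      (sum_measureReal_fibre μ (measurable_iteratedJoin hf hP m)).le
      fun b hb => (Finset.mem_filter.1 hb).2
  have hScard : ∀ j ∈ Finset.range m, (S j).card ≤ B.card * (k ^ m * k ^ (2 * m)) := by
    intro j hj
    have hjm := Finset.mem_range.1 hj
    have hcard : (B ×ˢ (Finset.univ : Finset (Fin m → Fin k)) ×ˢ
        (Finset.univ : Finset (Fin (2 * m) → Fin k))).card = B.card * (k ^ m * k ^ (2 * m)) := by
      simp
    rw [← hcard]
    -- A word is recovered from its blocks at offset `j`, its first `m` letters and its last `2 * m`
    -- letters.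
    refine Finset.card_le_card_of_injOn (fun w => (fun l => iteratedJoin f P m
      (f^[j + m * l] (r w)), iteratedJoin f P m (r w),
      iteratedJoin f P (2 * m) (f^[n - 2 * m] (r w)))) ?_ ?_
    · intro w hw
      obtain ⟨hwW, hwT⟩ := Finset.mem_filter.1 hw
      simp only [Finset.coe_product, Finset.coe_univ, mem_prod, mem_univ, and_true,
        Finset.mem_coe, hB, Finset.mem_filter, Finset.mem_univ, true_and]
      rw [← Real.le_log_iff_exp_le (Finset.prod_pos fun l _ => hpos w hwW _),
        Real.log_prod fun l _ => (hpos w hwW _).ne', neg_le, ← Finset.sum_neg_distrib,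
        Fin.sum_univ_eq_sum_range
          (fun l => -Real.log (p (iteratedJoin f P m (f^[j + m * l] (r w)))))]
      exact hwT
    · intro w hw w' hw' heq
      have hwW := (Finset.mem_filter.1 hw).1
      have hwW' := (Finset.mem_filter.1 hw').1
      simp only [Prod.mk.injEq] at heq
      obtain ⟨h1, h2, h3⟩ := heq
      rw [← hr w hwW, ← hr w' hwW']
      funext ⟨i, hi⟩
      simp only [iteratedJoin]
      rcases lt_or_ge i j with hij | hij
      · exact congrFun h2 ⟨i, hij.trans hjm⟩
      rcases lt_or_ge i (j + m * L) with hiL | hiL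
      · have hl : (i - j) / m < L := (Nat.div_lt_iff_lt_mul hm).2 (by rw [mul_comm]; omega)
        have := congrFun (congrFun h1 ⟨_, hl⟩) ⟨(i - j) % m, Nat.mod_lt _ hm⟩
        simp only [iteratedJoin, ← Function.iterate_add_apply] at this
        have hi' : (i - j) % m + (j + m * ((i - j) / m)) = i := by
          have := Nat.div_add_mod (i - j) m
          omega
        rwa [hi'] at this
      · have := congrFun h3 ⟨i - (n - 2 * m), by omega⟩
        simp only [iteratedJoin, ← Function.iterate_add_apply] at this
        have hi' : i - (n - 2 * m) + (n - 2 * m) = i := by omega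
        rwa [hi'] at this
  calc (W.card : ℝ) ≤ ∑ j ∈ Finset.range m, ((S j).card : ℝ) := by
        exact_mod_cast (Finset.card_le_card hcover).trans Finset.card_biUnion_le
    _ ≤ ∑ j ∈ Finset.range m, Real.exp T * ((k : ℝ) ^ m * (k : ℝ) ^ (2 * m)) := by
        refine Finset.sum_le_sum fun j hj => ?_
        refine le_trans (b := (B.card : ℝ) * ((k : ℝ) ^ m * (k : ℝ) ^ (2 * m))) ?_ (by gcongr)
        exact_mod_cast hScard j hj
    _ = _ := by simp

/-- For an ergodic map, all but `ε` of the space is covered by at most `C * exp (c * n)` names of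
length `n`, for every `c` larger than the entropy of the partition. -/
theorem eventually_exists_words [Nonempty X] {k : ℕ} {μ : Measure X} [IsProbabilityMeasure μ]
    {f : X → X} (hf : Ergodic f μ) {P : X → Fin k} (hP : Measurable P) {c : ℝ}
    (hc : ksEntropyOf μ f P < c) : ∃ C : ℝ, ∀ ε > 0, ∀ᶠ n : ℕ in atTop,
      ∃ W : Finset (Fin n → Fin k), 1 - ε < μ.real (iteratedJoin f P n ⁻¹' W) ∧
        (W.card : ℝ) ≤ C * Real.exp (c * n) := by
  classical
  -- A single block length with `H_m / m < c` suffices. The mean of the information function `g` is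
  -- then `H_m < m * c`, and the gap is the tolerance in the ergodic theorem.
  obtain ⟨m, hmc, hm⟩ := ((eventually_lt_of_limsup_lt hc).and (eventually_gt_atTop 0)).exists
  have hQ := measurable_iteratedJoin hf.measurable hP m
  set p : (Fin m → Fin k) → ℝ := fun v => μ.real (iteratedJoin f P m ⁻¹' {v}) with hp
  set g : X → ℝ := fun x => -Real.log (p (iteratedJoin f P m x)) with hg
  have hgm : Measurable g :=
    (measurable_of_finite fun v => -Real.log (p v)).comp hQ
  have hgL : MemLp g 2 μ := by
    refine MemLp.of_bound hgm.aestronglyMeasurable (∑ v, ‖-Real.log (p v)‖)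
      (Eventually.of_forall fun x => ?_)
    exact Finset.single_le_sum (f := fun v => ‖-Real.log (p v)‖) (fun _ _ => norm_nonneg _)
      (Finset.mem_univ (iteratedJoin f P m x))
  have hgint : ∫ x, g x ∂μ = shannonEntropy μ (iteratedJoin f P m) := by
    rw [hg, integral_comp_eq_sum_fibre μ hQ (fun v => -Real.log (p v))]
    simp [shannonEntropy, Real.negMulLog, hp]
  have hδ : 0 < m * c - shannonEntropy μ (iteratedJoin f P m) := by
    have : shannonEntropy μ (iteratedJoin f P m) / m < c := by exact_mod_cast hmc
    rw [div_lt_iff₀ (by exact_mod_cast hm)] at this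
    linarith
  have hpos : ∀ᵐ x ∂μ, ∀ i, 0 < p (iteratedJoin f P m (f^[i] x)) := ae_all_iff.2 fun i =>
    (hf.toMeasurePreserving.iterate i).quasiMeasurePreserving.ae
      (ae_measureReal_fibre_pos μ (iteratedJoin f P m))
  refine ⟨m * ((k : ℝ) ^ m * (k : ℝ) ^ (2 * m)), fun ε hε => ?_⟩
  have hlim := tendstoInMeasure_birkhoffAverage hf hgL _ (ENNReal.ofReal_pos.2 hδ)
  filter_upwards [hlim.eventually_lt_const (ENNReal.ofReal_pos.2 hε),
    eventually_ge_atTop (2 * m), eventually_gt_atTop 0] with n hn hmn hn0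
  set E : Set X := {x | (∀ i, 0 < p (iteratedJoin f P m (f^[i] x))) ∧
    ∑ i ∈ Finset.range n, g (f^[i] x) ≤ m * (c * n)} with hE
  refine ⟨Finset.univ.filter fun w => ∃ x ∈ E, iteratedJoin f P n x = w, ?_, ?_⟩
  · have hcompl : μ.real Eᶜ < ε := by
      refine (ENNReal.toReal_lt_of_lt_ofReal (lt_of_le_of_lt (measure_mono_ae ?_) hn))
      filter_upwards [hpos] with x hx hxE
      by_contra hlt
      refine hxE ⟨hx, ?_⟩
      replace hlt : edist (birkhoffAverage ℝ f g n x) (∫ x, g x ∂μ) <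
        ENNReal.ofReal (m * c - shannonEntropy μ (iteratedJoin f P m)) := not_le.1 hlt
      rw [edist_lt_ofReal, hgint, Real.dist_eq] at hlt
      have h1 := (abs_lt.1 hlt).2
      have h2 : birkhoffAverage ℝ f g n x ≤ m * c := by linarith
      rw [birkhoffAverage, smul_eq_mul, inv_mul_le_iff₀ (by exact_mod_cast hn0)] at h2
      calc _ ≤ _ := h2
        _ = _ := by ring
    -- Subadditivity suffices, so `E` need not be shown measurable.
    have h1 : (1 : ℝ) ≤ μ.real E + μ.real Eᶜ := by
      have := measureReal_union_le (μ := μ) E Eᶜ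
      simpa using this
    have h2 : μ.real E ≤ μ.real (iteratedJoin f P n ⁻¹'
        ↑(Finset.univ.filter fun w => ∃ x ∈ E, iteratedJoin f P n x = w)) :=
      measureReal_mono fun x hx => by simpa using ⟨x, hx, rfl⟩
    linarith
  · refine (card_words_le (μ := μ) hf.measurable hP hm hmn (T := c * n) ?_).trans_eq (by ring)
    intro w hw
    obtain ⟨x, ⟨hx1, hx2⟩, rfl⟩ := (Finset.mem_filter.1 hw).2
    exact ⟨x, rfl, hx1, hx2⟩

/-- Representatives of a finite set of names inside a prescribed set. -/
theorem exists_finset_representatives {α β : Type*} (Q : α → β) (G : Set α)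
    (W : Finset β) : ∃ F : Finset α, F.card ≤ W.card ∧
      ∀ y ∈ G, Q y ∈ W → ∃ x ∈ F, x ∈ G ∧ Q x = Q y := by
  classical
  rcases isEmpty_or_nonempty α with h | h
  · exact ⟨∅, by simp, fun y => h.elim y⟩
  have : ∀ w ∈ Q '' G, ∃ x, x ∈ G ∧ Q x = w := fun w ⟨x, hx, hw⟩ => ⟨x, hx, hw⟩
  choose! r hr using this
  refine ⟨W.image r, Finset.card_image_le, fun y hy hyW => ?_⟩
  exact ⟨r (Q y), Finset.mem_image_of_mem r hyW, hr _ (mem_image_of_mem Q hy)⟩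

end

/-! ### Lower bound: a Fano-type inequality -/

/-- Gibbs' inequality, from `log t ≤ t - 1` at `t = q v / p v`. It allows entropy to be bounded by
any convenient positive subprobability `q`. -/
theorem sum_negMulLog_le_sum_mul_neg_log {V : Type*} [Fintype V] {p q : V → ℝ}
    (hp : ∀ v, 0 ≤ p v) (hp1 : ∑ v, p v = 1) (hq : ∀ v, 0 < q v) (hq1 : ∑ v, q v ≤ 1) :
    ∑ v, Real.negMulLog (p v) ≤ ∑ v, p v * -Real.log (q v) := by
  have h : ∀ v, Real.negMulLog (p v) ≤ p v * -Real.log (q v) + (q v - p v) := by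
    intro v
    rcases (hp v).eq_or_lt with h0 | h0
    · simp [← h0, (hq v).le]
    · have h1 := mul_le_mul_of_nonneg_left (Real.log_le_sub_one_of_pos (div_pos (hq v) h0)) h0.le
      rw [Real.log_div (hq v).ne' h0.ne', mul_sub, mul_sub, mul_div_cancel₀ _ h0.ne'] at h1
      rw [Real.negMulLog]
      linarith
  calc _ ≤ ∑ v, (p v * -Real.log (q v) + (q v - p v)) := Finset.sum_le_sum fun v _ => h v
    _ ≤ _ := by
      rw [Finset.sum_add_distrib, Finset.sum_sub_distrib]
      linarith

/-- The transition matrix on `k` letters that keeps a letter with probability about `1 - ε`. -/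
noncomputable def noiseKernel (k : ℕ) (ε : ℝ) (a b : Fin k) : ℝ := if a = b then 1 - ε else ε / k

theorem noiseKernel_pos {k : ℕ} {ε : ℝ} (h0 : 0 < ε) (h1 : ε < 1) (a b : Fin k) :
    0 < noiseKernel k ε a b := by
  have : (0 : ℝ) < k := by exact_mod_cast a.pos
  unfold noiseKernel
  split_ifs
  · linarith
  · positivity

theorem sum_noiseKernel_le {k : ℕ} {ε : ℝ} (h0 : 0 < ε) (a : Fin k) :
    ∑ b, noiseKernel k ε a b ≤ 1 := by
  have hk : (0 : ℝ) < k := by exact_mod_cast a.pos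
  calc _ ≤ ∑ b, ((if a = b then 1 - ε else 0) + ε / k) := by
        refine Finset.sum_le_sum fun b _ => ?_
        unfold noiseKernel
        split_ifs
        · linarith [div_pos h0 hk]
        · linarith
    _ = 1 := by
        rw [Finset.sum_add_distrib]
        simp
        field_simp
        ring

theorem sum_prod_noiseKernel_le {k n : ℕ} {ε : ℝ} (h0 : 0 < ε) (h1 : ε < 1) (u : Fin n → Fin k) :
    ∑ w : Fin n → Fin k, ∏ i, noiseKernel k ε (u i) (w i) ≤ 1 := by
  have := Finset.prod_univ_sum (fun _ : Fin n => (Finset.univ : Finset (Fin k)))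
    (fun i b => noiseKernel k ε (u i) b)
  rw [Fintype.piFinset_univ] at this
  rw [← this]
  exact Finset.prod_le_one (fun i _ => Finset.sum_nonneg fun b _ => (noiseKernel_pos h0 h1 _ _).le)
    fun i _ => sum_noiseKernel_le h0 _

/-- Every letter is charged `-log (1 - ε)` and each of the at most `ε * n` mismatches `log (k / ε)`.
The resulting cost per letter vanishes as `ε → 0`. -/
theorem neg_log_prod_noiseKernel_le {k n : ℕ} {ε : ℝ} (h0 : 0 < ε) (h1 : ε < 1)
    {u w : Fin n → Fin k} (h : ((Finset.univ.filter fun i => u i ≠ w i).card : ℝ) ≤ ε * n) :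
    -Real.log (∏ i, noiseKernel k ε (u i) (w i)) ≤
      n * (-Real.log (1 - ε) + Real.negMulLog ε + ε * Real.log k) := by
  rcases Nat.eq_zero_or_pos n with rfl | hn
  · simp
  have hk : 1 ≤ (k : ℝ) := by exact_mod_cast (u ⟨0, hn⟩).pos
  have hlog : 0 ≤ Real.log (k / ε) := Real.log_nonneg (by rw [le_div_iff₀ h0]; linarith)
  have hlog1 : 0 ≤ -Real.log (1 - ε) := neg_nonneg.2 (Real.log_nonpos (by linarith) (by linarith))
  rw [Real.log_prod fun i _ => (noiseKernel_pos h0 h1 _ _).ne', ← Finset.sum_neg_distrib]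
  calc _ ≤ ∑ i : Fin n, (-Real.log (1 - ε) + if u i ≠ w i then Real.log (k / ε) else 0) := by
        refine Finset.sum_le_sum fun i _ => ?_
        unfold noiseKernel
        by_cases hi : u i = w i
        · simp [hi]
        · rw [if_neg hi, if_pos hi, ← Real.log_inv, inv_div]
          linarith
    _ = n * -Real.log (1 - ε) +
          (Finset.univ.filter fun i => u i ≠ w i).card * Real.log (k / ε) := by
        rw [Finset.sum_add_distrib, ← Finset.sum_filter]
        simp
    _ ≤ n * -Real.log (1 - ε) + ε * n * Real.log (k / ε) := by gcongr
    _ = _ := by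
        rw [Real.log_div (by linarith) h0.ne', Real.negMulLog]
        ring

theorem hammingDistance_eq {X : Type*} {k : ℕ} (f : X → X) (P : X → Fin k) {n : ℕ} (hn : 0 < n)
    (x y : X) : hammingDistance f P n x y =
      ((Finset.range n).filter fun s => P (f^[s] x) ≠ P (f^[s] y)).card / n := by
  have h := Finset.card_filter_add_card_filter_not (s := Finset.range n)
    (fun s => P (f^[s] x) = P (f^[s] y))
  rw [Finset.card_range] at h
  have hn' : (n : ℝ) ≠ 0 := by positivity
  rw [hammingDistance, eq_div_iff hn', sub_mul, div_mul_cancel₀ _ hn', one_mul]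
  nth_rewrite 1 [← h]
  push_cast
  ring

theorem card_ne_le_of_mem_hammingBall {X : Type*} {k : ℕ} {f : X → X} {P : X → Fin k} {n : ℕ}
    (hn : 0 < n) {x y : X} {ε : ℝ} (h : y ∈ hammingBall f P n x ε) :
    ((Finset.univ.filter fun i => iteratedJoin f P n x i ≠ iteratedJoin f P n y i).card : ℝ) ≤
      ε * n := by
  have h' : hammingDistance f P n x y < ε := h
  rw [hammingDistance_eq f P hn, div_lt_iff₀ (by positivity)] at h'
  refine le_trans (le_of_eq ?_) h'.le
  rw [Finset.card_filter, Finset.card_filter]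
  norm_cast
  exact Fin.sum_univ_eq_sum_range (fun i => if P (f^[i] x) ≠ P (f^[i] y) then 1 else 0) n

section

variable {X : Type*} [MeasurableSpace X]

/-- A Fano-type inequality: Hamming balls that cover all but `ε` of the space bound the entropy. -/
theorem shannonEntropy_iteratedJoin_le {k : ℕ} {μ : Measure X} [IsProbabilityMeasure μ] {f : X → X}
    (hf : Measurable f) {P : X → Fin k} (hP : Measurable P) {ε : ℝ} (h0 : 0 < ε) (h1 : ε < 1)
    {n : ℕ} (hn : 0 < n) {F : Finset X} (hF : 1 - ε < μ.real (⋃ x ∈ F, hammingBall f P n x ε)) :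
    shannonEntropy μ (iteratedJoin f P n) ≤ Real.log 2 + Real.log F.card +
      n * (-Real.log (1 - ε) + Real.negMulLog ε + ε * Real.log k + ε * Real.log k) := by
  classical
  have hQ := measurable_iteratedJoin hf hP n
  have hFne : F.Nonempty := by
    by_contra h
    rw [Finset.not_nonempty_iff_eq_empty] at h
    simp [h] at hF
    linarith
  have hk : 1 ≤ (k : ℝ) := by
    obtain ⟨x, -⟩ := hFne
    exact_mod_cast (P x).pos
  have hFc : (1 : ℝ) ≤ F.card := by exact_mod_cast hFne.card_pos
  set p : (Fin n → Fin k) → ℝ := fun w => μ.real (iteratedJoin f P n ⁻¹' {w}) with hp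
  have hpsum : ∑ w, p w = 1 := sum_measureReal_fibre μ hQ
  set R : X → (Fin n → Fin k) → ℝ := fun x w =>
    ∏ i, noiseKernel k ε (iteratedJoin f P n x i) (w i) with hR
  have hRpos : ∀ x w, 0 < R x w := fun x w => Finset.prod_pos fun i _ => noiseKernel_pos h0 h1 _ _
  -- Reference weights for Gibbs' inequality: half uniform, half a noisy copy of a uniformly chosen
  -- centre. The second half makes words near a centre cheap; the first caps the cost of any word at
  -- `log 2 + n * log k`, paid with probability less than `ε`.
  set q : (Fin n → Fin k) → ℝ := fun w =>
    2⁻¹ * (((k : ℝ) ^ n)⁻¹ + (F.card : ℝ)⁻¹ * ∑ x ∈ F, R x w) with hq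
  have hSpos : ∀ w, 0 ≤ ∑ x ∈ F, R x w := fun w => Finset.sum_nonneg fun x _ => (hRpos x w).le
  have hq1 : ∀ w, 2⁻¹ * ((k : ℝ) ^ n)⁻¹ ≤ q w := fun w => by
    have := hSpos w
    simp only [hq]
    gcongr
    exact le_add_of_nonneg_right (by positivity)
  have hqpos : ∀ w, 0 < q w := fun w => lt_of_lt_of_le (by positivity) (hq1 w)
  have hqsum : ∑ w, q w ≤ 1 := by
    have h2 : ∑ w, ∑ x ∈ F, R x w ≤ F.card := by
      rw [Finset.sum_comm]
      exact (Finset.sum_le_sum fun x _ => sum_prod_noiseKernel_le h0 h1 _).trans_eq (by simp)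
    have h3 : (F.card : ℝ)⁻¹ * ∑ w, ∑ x ∈ F, R x w ≤ 1 := by
      rw [inv_mul_le_iff₀ (by linarith)]
      linarith
    simp only [hq]
    rw [← Finset.mul_sum, Finset.sum_add_distrib, ← Finset.mul_sum]
    have h4 : ∑ w : Fin n → Fin k, ((k : ℝ) ^ n)⁻¹ = 1 := by
      simp
      field_simp
    rw [h4]
    linarith
  set W : Finset (Fin n → Fin k) := Finset.univ.filter fun w => ∃ x ∈ F,
    ((Finset.univ.filter fun i => iteratedJoin f P n x i ≠ w i).card : ℝ) ≤ ε * n with hW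
  have hWμ : 1 - ε < ∑ w ∈ W, p w := by
    rw [sum_measureReal_preimage_singleton W fun w _ => hQ (measurableSet_singleton w)]
    refine hF.trans_le (measureReal_mono fun y hy => ?_)
    obtain ⟨x, hx, hxy⟩ := mem_iUnion₂.1 hy
    simpa [hW] using ⟨x, hx, by simpa using card_ne_le_of_mem_hammingBall hn hxy⟩
  set b := -Real.log (1 - ε) + Real.negMulLog ε + ε * Real.log k with hb
  have hlogk : 0 ≤ Real.log k := Real.log_nonneg hk
  have hb0 : 0 ≤ b := by
    have := Real.log_nonpos (x := 1 - ε) (by linarith) (by linarith)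
    have := Real.negMulLog_nonneg h0.le h1.le
    have : 0 ≤ ε * Real.log k := by positivity
    linarith
  have hlogF : 0 ≤ Real.log F.card := Real.log_nonneg hFc
  have hqlog : ∀ w, -Real.log (q w) ≤
      (Real.log 2 + Real.log F.card + n * b) + if w ∈ W then 0 else n * Real.log k := by
    intro w
    split_ifs with hw
    · obtain ⟨x, hx, hxw⟩ := (Finset.mem_filter.1 hw).2
      have h2 : 2⁻¹ * ((F.card : ℝ)⁻¹ * R x w) ≤ q w := by
        have := Finset.single_le_sum (f := fun x => R x w) (fun x _ => (hRpos x w).le) hx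
        simp only [hq]
        gcongr
        refine le_add_of_nonneg_of_le (by positivity) ?_
        gcongr
      have h3 := Real.log_le_log (mul_pos (by norm_num) (mul_pos (by positivity) (hRpos x w))) h2
      rw [Real.log_mul (by norm_num) (mul_pos (by positivity) (hRpos x w)).ne',
        Real.log_mul (by positivity) (hRpos x w).ne', Real.log_inv, Real.log_inv] at h3
      have h4 := neg_log_prod_noiseKernel_le h0 h1 hxw
      change -Real.log (R x w) ≤ n * b at h4
      linarith
    · have h3 := Real.log_le_log (by positivity) (hq1 w)
      rw [Real.log_mul (by norm_num) (by positivity), Real.log_inv, Real.log_inv,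
        Real.log_pow] at h3
      have : 0 ≤ n * b := by positivity
      linarith
  calc shannonEntropy μ (iteratedJoin f P n) ≤ ∑ w, p w * -Real.log (q w) :=
        sum_negMulLog_le_sum_mul_neg_log (fun _ => measureReal_nonneg) hpsum hqpos hqsum
    _ ≤ ∑ w, p w * ((Real.log 2 + Real.log F.card + n * b) +
          if w ∈ W then 0 else n * Real.log k) := Finset.sum_le_sum fun w _ =>
        mul_le_mul_of_nonneg_left (hqlog w) measureReal_nonneg
    _ = (Real.log 2 + Real.log F.card + n * b) + (1 - ∑ w ∈ W, p w) * (n * Real.log k) := by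
        simp only [mul_add _ (Real.log 2 + Real.log F.card + n * b)]
        rw [Finset.sum_add_distrib, ← Finset.sum_mul, hpsum, one_mul, ← hpsum,
          ← Finset.sum_compl_add_sum W p, add_sub_cancel_right, Finset.sum_mul]
        congr 1
        simp only [mul_ite, mul_zero]
        rw [Finset.sum_ite, Finset.sum_const_zero, zero_add]
        refine Finset.sum_congr ?_ fun _ _ => rfl
        ext w
        simp
    _ ≤ (Real.log 2 + Real.log F.card + n * b) + ε * (n * Real.log k) := by
        gcongr
        linarith
    _ = _ := by ring

theorem shannonEntropy_nonneg {ι : Type*} [Fintype ι] (μ : Measure X) [IsProbabilityMeasure μ]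
    (Q : X → ι) : 0 ≤ shannonEntropy μ Q :=
  Finset.sum_nonneg fun _ _ => Real.negMulLog_nonneg measureReal_nonneg measureReal_le_one

theorem ksEntropyOf_nonneg {k : ℕ} (μ : Measure X) [IsProbabilityMeasure μ] (f : X → X)
    (P : X → Fin k) : 0 ≤ ksEntropyOf μ f P :=
  le_limsup_of_frequently_le (Frequently.of_forall fun n => by
    exact_mod_cast div_nonneg (shannonEntropy_nonneg μ _) (Nat.cast_nonneg n))

theorem ksEntropyOf_le_metricSlowEntropyOf {k : ℕ} {μ : Measure X} [IsProbabilityMeasure μ]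
    {f : X → X} (hf : Measurable f) {P : X → Fin k} (hP : Measurable P) :
    ksEntropyOf μ f P ≤ metricSlowEntropyOf expScale μ f P := by
  refine EReal.ge_of_forall_gt_iff_ge.1 fun c hc => ?_
  rcases lt_or_ge c 0 with hc0 | hc0
  · exact (EReal.coe_le_coe_iff.2 hc0.le).trans (EReal.coe_ennreal_nonneg _)
  obtain ⟨c', hcc', hc'⟩ := EReal.lt_iff_exists_real_btwn.1 hc
  replace hcc' : c < c' := by exact_mod_cast hcc'
  have hB : Tendsto (fun ε : ℝ => -Real.log (1 - ε) + Real.negMulLog ε + ε * Real.log k +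
      ε * Real.log k) (𝓝[>] 0) (𝓝 0) := by
    have : ContinuousAt (fun ε : ℝ => -Real.log (1 - ε) + Real.negMulLog ε + ε * Real.log k +
      ε * Real.log k) 0 := by
      have := Real.continuous_negMulLog.continuousAt (x := 0)
      have : ContinuousAt (fun ε : ℝ => Real.log (1 - ε)) 0 :=
        ContinuousAt.log (by fun_prop) (by norm_num)
      fun_prop
    have h := this.tendsto.mono_left (nhdsWithin_le_nhds (s := Ioi 0))
    simpa using h
  suffices ENNReal.ofReal c ≤ metricSlowEntropyOf expScale μ f P by
    rw [← max_eq_left hc0, ← EReal.coe_ennreal_ofReal]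
    exact_mod_cast this
  refine le_limsup_of_frequently_le (Eventually.frequently ?_)
  filter_upwards [hB.eventually_lt_const (sub_pos.2 hcc'), self_mem_nhdsWithin,
    nhdsWithin_le_nhds (Iio_mem_nhds one_pos)] with ε hεB hε0 hε1
  -- The factor `2⁻¹` absorbs the `log 2` of the Fano bound, and `c' - c` absorbs its error per
  -- letter.
  refine ofReal_le_growth_expScale (C := 2⁻¹) hc0 (by norm_num) ?_
  refine ((frequently_lt_of_lt_limsup (by isBoundedDefault) hc').and_eventually
    (eventually_gt_atTop 0)).mono fun n ⟨hn, hn0⟩ => ?_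
  have hn' : (0 : ℝ) < n := by exact_mod_cast hn0
  replace hn : c' < shannonEntropy μ (iteratedJoin f P n) / n := by exact_mod_cast hn
  rw [lt_div_iff₀ hn'] at hn
  have key : ∀ F : Finset X, 1 - ε < μ.real (⋃ x ∈ F, hammingBall f P n x ε) →
      2⁻¹ * Real.exp (c * n) ≤ F.card := by
    intro F hF
    have h := shannonEntropy_iteratedJoin_le hf hP hε0 hε1 hn0 hF
    have hFpos : (0 : ℝ) < F.card := by
      rcases F.eq_empty_or_nonempty with rfl | hne
      · simp at hF
        linarith [show ε < 1 from hε1]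
      · exact_mod_cast hne.card_pos
    have h2 := mul_lt_mul_of_pos_left hεB hn'
    rw [inv_mul_le_iff₀ two_pos, ← Real.le_log_iff_exp_le (by positivity),
      Real.log_mul two_ne_zero hFpos.ne']
    nlinarith
  rw [hammingCoverNumber, ENat.toENNReal_iInf]
  refine le_iInf fun F => ?_
  rw [ENat.toENNReal_iInf]
  refine le_iInf fun hF => ENNReal.ofReal_le_of_le_toReal ?_
  simpa using key F hF

end

/-! ### Metric slow entropy equals Kolmogorov–Sinai entropy -/

/-- The constant `C` may depend on `ε`; in the semi-topological case it comes from a partition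
chosen after `ε`. -/
theorem limsup_growth_le_of_forall {N : ℝ → ℕ → ℕ∞} {h : EReal} (h0 : 0 ≤ h)
    (H : ∀ c : ℝ, h < c → ∀ ε > 0, ∃ C : ℝ, ∀ᶠ n : ℕ in atTop,
      (N ε n : ℝ≥0∞) ≤ ENNReal.ofReal (C * Real.exp (c * n))) :
    ((limsup (fun ε => growth expScale (N ε)) (𝓝[>] 0) : ℝ≥0∞) : EReal) ≤ h := by
  refine EReal.le_of_forall_lt_iff_le.1 fun c hc => ?_
  have hc0 : 0 ≤ c := by exact_mod_cast (h0.trans_lt hc).le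
  suffices limsup (fun ε => growth expScale (N ε)) (𝓝[>] 0) ≤ ENNReal.ofReal c by
    rw [← max_eq_left hc0, ← EReal.coe_ennreal_ofReal]
    exact_mod_cast this
  refine limsup_le_of_le (by isBoundedDefault) ?_
  filter_upwards [self_mem_nhdsWithin] with ε hε
  obtain ⟨C, hC⟩ := H c hc ε hε
  exact growth_expScale_le hc0 hC

theorem growth_mono_of_eventuallyLE (a : Scale) {N M : ℕ → ℕ∞} (h : N ≤ᶠ[atTop] M) :
    growth a N ≤ growth a M :=
  iSup_mono fun _ => iSup_mono' fun hχ => ⟨hχ.trans_le (limsup_le_limsup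
    (h.mono fun _ hn => ENNReal.div_le_div_right (ENat.toENNReal_mono hn) _)), le_rfl⟩

section Metric

variable {X : Type*} [MeasurableSpace X]

theorem metricSlowEntropyOf_le_ksEntropyOf [Nonempty X] {k : ℕ} {μ : Measure X}
    [IsProbabilityMeasure μ] {f : X → X} (hf : Ergodic f μ) {P : X → Fin k} (hP : Measurable P) :
    (metricSlowEntropyOf expScale μ f P : EReal) ≤ ksEntropyOf μ f P := by
  refine limsup_growth_le_of_forall (ksEntropyOf_nonneg μ f P) fun c hc ε hε => ?_
  obtain ⟨C, hC⟩ := eventually_exists_words hf hP hc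
  refine ⟨C, ?_⟩
  filter_upwards [hC ε hε, eventually_gt_atTop 0] with n ⟨W, hWμ, hWC⟩ hn
  -- One point per name: points with equal names are at Hamming distance `0`.
  obtain ⟨F, hFW, hF⟩ := exists_finset_representatives (iteratedJoin f P n) univ W
  have hle : hammingCoverNumber μ f P ε n ≤ F.card := by
    refine iInf₂_le F (hWμ.trans_le (measureReal_mono (fun y hy => ?_) (measure_ne_top _ _)))
    obtain ⟨x, hxF, -, hxy⟩ := hF y (mem_univ y) hy
    refine mem_iUnion₂.2 ⟨x, hxF, ?_⟩
    have hall : ∀ s ∈ Finset.range n, ¬ P (f^[s] x) ≠ P (f^[s] y) := fun s hs =>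
      not_not.2 (congrFun hxy ⟨s, Finset.mem_range.1 hs⟩)
    rw [hammingBall, mem_ofPred_eq, hammingDistance_eq f P hn, Finset.filter_false_of_mem hall]
    simpa using hε
  refine (ENat.toENNReal_mono hle).trans ?_
  rw [ENat.toENNReal_coe, ← ENNReal.ofReal_natCast]
  exact ENNReal.ofReal_le_ofReal ((Nat.cast_le.2 hFW).trans hWC)

theorem ksEntropyOf_le_ksEntropy {k : ℕ} (μ : Measure X)
    (f : X → X) {P : X → Fin k} (hP : Measurable P) : ksEntropyOf μ f P ≤ ksEntropy μ f :=
  le_iSup_of_le (f := fun k => ⨆ (P : X → Fin k) (_ : Measurable P), ksEntropyOf μ f P) k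
    (le_iSup₂_of_le P hP le_rfl)

theorem ksEntropy_nonneg (μ : Measure X) [IsProbabilityMeasure μ] (f : X → X) :
    0 ≤ ksEntropy μ f :=
  (ksEntropyOf_nonneg μ f fun _ => (0 : Fin 1)).trans
    (ksEntropyOf_le_ksEntropy μ f measurable_const)

theorem metricSlowEntropy_expScale [Nonempty X] {μ : Measure X} [IsProbabilityMeasure μ]
    {f : X → X} (hf : Ergodic f μ) :
    (metricSlowEntropy expScale μ f : EReal) = ksEntropy μ f := by
  apply le_antisymm
  · have h0 := ksEntropy_nonneg μ f
    generalize hb : ksEntropy μ f = b at h0 ⊢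
    lift b to ℝ≥0∞ using h0
    rw [EReal.coe_ennreal_le_coe_ennreal_iff]
    refine iSup_le fun k => iSup₂_le fun P hP => ?_
    rw [← EReal.coe_ennreal_le_coe_ennreal_iff, ← hb]
    exact (metricSlowEntropyOf_le_ksEntropyOf hf hP).trans (ksEntropyOf_le_ksEntropy μ f hP)
  · refine iSup_le fun k => iSup₂_le fun P hP => ?_
    refine (ksEntropyOf_le_metricSlowEntropyOf hf.measurable hP).trans ?_
    exact EReal.coe_ennreal_le_coe_ennreal_iff.2
      (le_iSup_of_le (f := fun k => ⨆ (P : X → Fin k) (_ : Measurable P),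
        metricSlowEntropyOf expScale μ f P) k (le_iSup₂_of_le P hP le_rfl))

/-- By invariance, the orbit of most points spends little time in a small set. -/
theorem measureReal_visits_le {μ : Measure X} [IsProbabilityMeasure μ] {f : X → X}
    (hf : MeasurePreserving f μ μ) {A : Set X} (hA : MeasurableSet A) {θ : ℝ} (hθ : 0 < θ)
    (hAθ : μ.real A ≤ θ ^ 2) (n : ℕ) (hn : 0 < n) [DecidablePred (· ∈ A)] :
    μ.real {y | θ * n ≤ ((Finset.range n).filter fun i => f^[i] y ∈ A).card} ≤ θ := by
  have hn' : (0 : ℝ) < n := by exact_mod_cast hn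
  set φ : X → ℝ := fun y => ∑ i ∈ Finset.range n, A.indicator (fun _ => (1 : ℝ)) (f^[i] y) with hφ
  have hφcard : ∀ y, φ y = ((Finset.range n).filter fun i => f^[i] y ∈ A).card := by
    intro y
    simp [hφ, indicator_apply]
  have hint : ∀ i, Integrable (fun y => A.indicator (fun _ => (1 : ℝ)) (f^[i] y)) μ := fun i =>
    (hf.iterate i).integrable_comp_of_integrable ((integrable_const 1).indicator hA)
  have hφint : ∫ y, φ y ∂μ = n * μ.real A := by
    rw [hφ, integral_finsetSum _ fun i _ => hint i]
    have : ∀ i, ∫ y, A.indicator (fun _ => (1 : ℝ)) (f^[i] y) ∂μ = μ.real A := by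
      intro i
      have h := integral_map (μ := μ) (hf.iterate i).measurable.aemeasurable
        (f := A.indicator fun _ => (1 : ℝ)) (measurable_const.indicator hA).aestronglyMeasurable
      rw [← h, (hf.iterate i).map_eq, integral_indicator_const _ hA]
      simp
    simp [this]
  have hmarkov := mul_meas_ge_le_integral_of_nonneg (μ := μ) (f := φ)
    (Eventually.of_forall fun y => by rw [hφcard]; positivity)
    (integrable_finsetSum _ fun i _ => hint i) (θ * n)
  rw [hφint] at hmarkov
  simp only [hφcard] at hmarkov
  have h2 : n * μ.real A ≤ θ * n * θ := by nlinarith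
  exact le_of_mul_le_mul_left (hmarkov.trans h2) (by positivity)

end Metric

/-! ### Semi-topological slow entropy -/

section SemiTopological

variable {X : Type*} [MetricSpace X] [MeasurableSpace X] [BorelSpace X]

/-- Up to a small set, the atoms of a finite partition are at a positive distance. -/
theorem exists_separated_subset {k : ℕ} (μ : Measure X) [IsProbabilityMeasure μ] {P : X → Fin k}
    (hP : Measurable P) {γ : ℝ} (hγ : 0 < γ) : ∃ D : Set X, MeasurableSet D ∧ μ.real Dᶜ < γ ∧
      ∃ η > 0, ∀ y ∈ D, ∀ z ∈ D, dist y z < η → P y = P z := by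
  have hex : ∀ j : Fin k, ∃ C ⊆ P ⁻¹' {j}, IsClosed C ∧
      μ (P ⁻¹' {j} \ C) < ENNReal.ofReal (γ / (k + 1)) := fun j =>
    (hP (measurableSet_singleton j)).exists_isClosed_sdiff_lt (measure_ne_top _ _)
      (ENNReal.ofReal_pos.2 (by positivity)).ne'
  choose C hCP hCc hCμ using hex
  have hCcompl : μ (⋃ j, C j)ᶜ < ENNReal.ofReal γ := by
    calc μ (⋃ j, C j)ᶜ ≤ μ (⋃ j, P ⁻¹' {j} \ C j) := by
          refine measure_mono fun x hx => mem_iUnion.2 ⟨P x, rfl, fun h => hx ?_⟩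
          exact mem_iUnion.2 ⟨_, h⟩
      _ ≤ ∑ j, μ (P ⁻¹' {j} \ C j) := measure_iUnion_fintype_le _ _
      _ ≤ ∑ _j : Fin k, ENNReal.ofReal (γ / (k + 1)) := Finset.sum_le_sum fun j _ => (hCμ j).le
      _ = ENNReal.ofReal (k * (γ / (k + 1))) := by
          rw [ENNReal.ofReal_mul (by positivity)]
          simp
      _ < ENNReal.ofReal γ := by
          refine (ENNReal.ofReal_lt_ofReal_iff hγ).2 ?_
          rw [mul_div_assoc', div_lt_iff₀ (by positivity)]
          linarith
  -- Disjoint closed sets may be at distance zero, so only points at distance at least `1 / (m + 1)`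
  -- from the other sets are kept. These sets increase to `⋃ j, C j`, and continuity of the measure
  -- selects `m`.
  set D : ℕ → Set X := fun m => ⋃ j, C j ∩
    {x | ENNReal.ofReal (1 / (m + 1)) ≤ Metric.infEDist x (⋃ i ∈ {i | i ≠ j}, C i)} with hD
  have hDm : ∀ m, MeasurableSet (D m) := fun m => MeasurableSet.iUnion fun j =>
    (hCc j).measurableSet.inter
      (isClosed_le continuous_const Metric.continuous_infEDist).measurableSet
  have hDmono : Monotone D := fun m m' hmm' => iUnion_mono fun j => inter_subset_inter_right _
    fun x hx => le_trans (ENNReal.ofReal_le_ofReal (one_div_le_one_div_of_le (by positivity)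
      (by gcongr))) hx
  have hDC : ⋃ m, D m = ⋃ j, C j := by
    refine Subset.antisymm (iUnion_subset fun m => iUnion_mono fun j => inter_subset_left) ?_
    refine iUnion_subset fun j x hx => ?_
    have hcl : IsClosed (⋃ i ∈ {i | i ≠ j}, C i) :=
      (toFinite _).isClosed_biUnion fun i _ => hCc i
    have hx' : x ∉ ⋃ i ∈ {i | i ≠ j}, C i := by
      intro h
      obtain ⟨i, hi, hxi⟩ := mem_iUnion₂.1 h
      exact hi ((hCP i hxi).symm.trans (hCP j hx))
    have hpos : 0 < Metric.infEDist x (⋃ i ∈ {i | i ≠ j}, C i) := by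
      rw [pos_iff_ne_zero]
      exact fun h => hx' ((Metric.mem_iff_infEDist_zero_of_closed hcl).2 h)
    have hlim : Tendsto (fun m : ℕ => ENNReal.ofReal (1 / (m + 1))) atTop (𝓝 0) := by
      rw [← ENNReal.ofReal_zero]
      exact ENNReal.tendsto_ofReal tendsto_one_div_add_atTop_nhds_zero_nat
    obtain ⟨m, hm⟩ := (hlim.eventually_lt_const hpos).exists
    exact mem_iUnion.2 ⟨m, mem_iUnion.2 ⟨j, hx, hm.le⟩⟩
  have hlim : Tendsto (fun m => μ (D m)ᶜ) atTop (𝓝 (μ (⋂ m, (D m)ᶜ))) :=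
    tendsto_measure_iInter_atTop (fun m => (hDm m).compl.nullMeasurableSet)
      (fun m m' h => compl_subset_compl.2 (hDmono h)) ⟨0, measure_ne_top _ _⟩
  rw [← compl_iUnion, hDC] at hlim
  obtain ⟨m, hm⟩ := (hlim.eventually_lt_const hCcompl).exists
  refine ⟨D m, hDm m, ENNReal.toReal_lt_of_lt_ofReal hm, 1 / (m + 1), by positivity,
    fun y hy z hz hyz => ?_⟩
  obtain ⟨j, hyj, hyd⟩ := mem_iUnion.1 hy
  obtain ⟨i, hzi, -⟩ := mem_iUnion.1 hz
  by_contra hne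
  have hPy : P y = j := hCP j hyj
  have hPz : P z = i := hCP i hzi
  have hij : i ≠ j := fun h => hne (by rw [hPy, hPz, h])
  have h1 : ENNReal.ofReal (1 / (m + 1)) ≤ edist y z :=
    le_trans hyd (Metric.infEDist_le_edist_of_mem (mem_biUnion (show i ∈ {i | i ≠ j} from hij) hzi))
  exact (h1.trans_lt (edist_lt_ofReal.2 hyz)).false

theorem eventually_hammingCoverNumber_le {k : ℕ} {μ : Measure X} [IsProbabilityMeasure μ]
    {f : X → X} (hf : MeasurePreserving f μ μ) {P : X → Fin k} (hP : Measurable P) {ε' : ℝ}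
    (hε' : 0 < ε') : ∀ᶠ ε in 𝓝[>] (0 : ℝ), ∀ n > 0,
      hammingCoverNumber μ f P ε' n ≤ semiTopCoverNumber μ f ε n := by
  classical
  obtain ⟨D, hD, hDμ, η, hη, hsep⟩ := exists_separated_subset μ hP
    (show 0 < (ε' / 2) ^ 2 by positivity)
  filter_upwards [nhdsWithin_le_nhds (Iio_mem_nhds (half_pos hη)),
    nhdsWithin_le_nhds (Iio_mem_nhds (half_pos hε'))] with ε hεη hεε' n hn
  have hn' : (0 : ℝ) < n := by exact_mod_cast hn
  refine le_iInf₂ fun F hF => ?_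
  -- Two points outside `B` each visit `Dᶜ` fewer than `ε' / 2 * n` times; at all other times,
  -- orbits less than `η` apart carry the same label.
  set B : Set X := {y | ε' / 2 * n ≤ ((Finset.range n).filter fun i => f^[i] y ∈ Dᶜ).card} with hB
  have hBμ : μ.real B ≤ ε' / 2 := measureReal_visits_le hf hD.compl (half_pos hε') hDμ.le n hn
  have hclose : ∀ x, ∀ y ∈ bowenBall f n x ε, ∀ z ∈ bowenBall f n x ε, y ∉ B → z ∉ B →
      y ∈ hammingBall f P n z ε' := by
    intro x y hy z hz hyB hzB
    simp only [hB, mem_ofPred_eq, not_le] at hyB hzB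
    rw [hammingBall, mem_ofPred_eq, hammingDistance_eq f P hn, div_lt_iff₀ hn']
    have hsub : ((Finset.range n).filter fun s => P (f^[s] z) ≠ P (f^[s] y)) ⊆
        ((Finset.range n).filter fun i => f^[i] z ∈ Dᶜ) ∪
          ((Finset.range n).filter fun i => f^[i] y ∈ Dᶜ) := by
      intro s hs
      obtain ⟨hsn, hne⟩ := Finset.mem_filter.1 hs
      by_contra hcon
      simp only [Finset.mem_union, Finset.mem_filter, hsn, true_and, mem_compl_iff, not_or,
        not_not] at hcon
      refine hne (hsep _ hcon.1 _ hcon.2 ?_)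
      have h1 := Metric.mem_ball.1 (hy s (Finset.mem_range.1 hsn))
      have h2 := Metric.mem_ball.1 (hz s (Finset.mem_range.1 hsn))
      have h3 := dist_triangle_right (f^[s] z) (f^[s] y) (f^[s] x)
      linarith [show ε < η / 2 from hεη]
    have hcard : (((Finset.range n).filter fun s => P (f^[s] z) ≠ P (f^[s] y)).card : ℝ) ≤
        ((Finset.range n).filter fun i => f^[i] z ∈ Dᶜ).card +
          ((Finset.range n).filter fun i => f^[i] y ∈ Dᶜ).card := by
      exact_mod_cast (Finset.card_le_card hsub).trans (Finset.card_union_le _ _)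
    linarith
  -- The centre of a Bowen ball may lie in `B`, so each centre is replaced by a point of its ball
  -- outside `B`.
  obtain ⟨r, hr⟩ : ∃ r : X → X, ∀ x, (bowenBall f n x ε \ B).Nonempty →
      r x ∈ bowenBall f n x ε \ B := by
    have : ∀ x, ∃ z, (bowenBall f n x ε \ B).Nonempty → z ∈ bowenBall f n x ε \ B := fun x => by
      by_cases h : (bowenBall f n x ε \ B).Nonempty
      · exact ⟨h.some, fun _ => h.some_mem⟩
      · exact ⟨x, fun h' => absurd h' h⟩
    choose r hr using this
    exact ⟨r, hr⟩
  refine iInf₂_le_of_le (F.image r) ?_ (by exact_mod_cast Finset.card_image_le)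
  have hsub : (⋃ x ∈ F, bowenBall f n x ε) ⊆ (⋃ z ∈ F.image r, hammingBall f P n z ε') ∪ B := by
    refine iUnion₂_subset fun x hx y hy => ?_
    by_cases hyB : y ∈ B
    · exact Or.inr hyB
    · have hz := hr x ⟨y, hy, hyB⟩
      exact Or.inl (mem_biUnion (Finset.mem_image_of_mem r hx) (hclose x y hy _ hz.1 hyB hz.2))
  have h1 := (measureReal_mono hsub (measure_ne_top μ _)).trans (measureReal_union_le _ _)
  linarith [show ε < ε' / 2 from hεε']

theorem metricSlowEntropyOf_le_semiTopSlowEntropy (a : Scale) {k : ℕ} {μ : Measure X}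
    [IsProbabilityMeasure μ] {f : X → X} (hf : MeasurePreserving f μ μ) {P : X → Fin k}
    (hP : Measurable P) : metricSlowEntropyOf a μ f P ≤ semiTopSlowEntropy a μ f := by
  refine limsup_le_of_le (by isBoundedDefault) ?_
  filter_upwards [self_mem_nhdsWithin] with ε' hε'
  refine le_limsup_of_frequently_le (Eventually.frequently ?_)
  filter_upwards [eventually_hammingCoverNumber_le hf hP hε'] with ε hε
  refine growth_mono_of_eventuallyLE a ?_
  filter_upwards [eventually_gt_atTop 0] with n hn using hε n hn

/-- A totally bounded set of full measure has a finite measurable partition whose atoms are small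
up to a null set. -/
theorem exists_measurable_partition_dist_lt [Nonempty X] {μ : Measure X} {K : Set X}
    (hK : TotallyBounded K) (hKμ : μ Kᶜ = 0) {ε : ℝ} (hε : 0 < ε) :
    ∃ (k : ℕ) (P : X → Fin k) (U : Set X), Measurable P ∧ (∀ᵐ x ∂μ, x ∈ U) ∧
      ∀ x ∈ U, ∀ y ∈ U, P x = P y → dist x y < ε := by
  obtain ⟨t, ht, hKt⟩ := Metric.totallyBounded_iff.1 hK (ε / 2) (half_pos hε)
  obtain ⟨N, e, he⟩ : ∃ (N : ℕ) (e : ℕ → X), ∀ y ∈ t, ∃ i ≤ N, e i = y := by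
    refine ⟨ht.toFinset.toList.length, fun i => ht.toFinset.toList.getD i (Classical.arbitrary X),
      fun y hy => ?_⟩
    obtain ⟨i, hi, hiy⟩ := List.mem_iff_getElem.1
      (Finset.mem_toList.2 (ht.mem_toFinset.2 hy))
    exact ⟨i, hi.le, (List.getD_eq_getElem _ _ hi).trans hiy⟩
  -- Labelling by the nearest point of a finite net is measurable on all of `X`, but controls
  -- distances only where the net is `ε / 2`-dense.
  have hdist : ∀ x ∈ ⋃ y ∈ t, Metric.ball y (ε / 2),
      dist (e (SimpleFunc.nearestPtInd e N x)) x < ε / 2 := by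
    intro x hx
    obtain ⟨y, hy, hxy⟩ := mem_iUnion₂.1 hx
    obtain ⟨i, hi, rfl⟩ := he y hy
    rw [← edist_lt_ofReal]
    refine (SimpleFunc.edist_nearestPt_le e x hi).trans_lt (edist_lt_ofReal.2 ?_)
    rw [dist_comm]
    exact hxy
  refine ⟨N + 1, fun x => Fin.ofNat (N + 1) (SimpleFunc.nearestPtInd e N x),
    ⋃ y ∈ t, Metric.ball y (ε / 2), ?_, ?_, fun x hx y hy hxy => ?_⟩
  · exact (measurable_from_top (f := Fin.ofNat (N + 1))).comp
      (SimpleFunc.nearestPtInd e N).measurable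
  · filter_upwards [measure_eq_zero_iff_ae_notMem.1 hKμ] with x hx using hKt (not_not.1 hx)
  · have h := congrArg Fin.val hxy
    simp only [Fin.ofNat] at h
    rw [Nat.mod_eq_of_lt (Nat.lt_succ_of_le (SimpleFunc.nearestPtInd_le e N x)),
      Nat.mod_eq_of_lt (Nat.lt_succ_of_le (SimpleFunc.nearestPtInd_le e N y))] at h
    have h1 := hdist x hx
    have h2 := hdist y hy
    rw [← h] at h2
    linarith [dist_triangle_left x y (e (SimpleFunc.nearestPtInd e N x))]

theorem semiTopSlowEntropy_expScale_le [Nonempty X] {μ : Measure X} [IsProbabilityMeasure μ]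
    {f : X → X} (hf : Ergodic f μ) {K : Set X} (hK : TotallyBounded K) (hKμ : μ Kᶜ = 0) :
    (semiTopSlowEntropy expScale μ f : EReal) ≤ ksEntropy μ f := by
  refine limsup_growth_le_of_forall (ksEntropy_nonneg μ f) fun c hc ε hε => ?_
  obtain ⟨k, P, U, hP, hU, hdist⟩ := exists_measurable_partition_dist_lt hK hKμ hε
  obtain ⟨C, hC⟩ := eventually_exists_words hf hP
    ((ksEntropyOf_le_ksEntropy μ f hP).trans_lt hc)
  have hGae : ∀ᵐ x ∂μ, ∀ i, f^[i] x ∈ U := ae_all_iff.2 fun i =>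
    (hf.toMeasurePreserving.iterate i).quasiMeasurePreserving.ae hU
  refine ⟨C, ?_⟩
  filter_upwards [hC ε hε] with n ⟨W, hWμ, hWC⟩
  -- Representatives are taken among points whose whole orbit stays in `U`, where equal labels mean
  -- distance less than `ε`.
  obtain ⟨F, hFW, hF⟩ := exists_finset_representatives (iteratedJoin f P n)
    {x | ∀ i, f^[i] x ∈ U} W
  have hle : semiTopCoverNumber μ f ε n ≤ F.card := by
    refine iInf₂_le F (hWμ.trans_le ?_)
    refine ENNReal.toReal_mono (measure_ne_top _ _) (measure_mono_ae ?_)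
    filter_upwards [hGae] with y hyG hyW
    obtain ⟨x, hxF, hxG, hxy⟩ := hF y hyG hyW
    exact mem_iUnion₂.2 ⟨x, hxF, fun i hi => hdist _ (hyG i) _ (hxG i)
      (congrFun hxy ⟨i, hi⟩).symm⟩
  refine (ENat.toENNReal_mono hle).trans ?_
  rw [ENat.toENNReal_coe, ← ENNReal.ofReal_natCast]
  exact ENNReal.ofReal_le_ofReal ((Nat.cast_le.2 hFW).trans hWC)

theorem semiTopSlowEntropy_expScale [Nonempty X] {μ : Measure X} [IsProbabilityMeasure μ]
    {f : X → X} (hf : Ergodic f μ) {K : Set X} (hK : TotallyBounded K) (hKμ : μ Kᶜ = 0) :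
    (semiTopSlowEntropy expScale μ f : EReal) = ksEntropy μ f := by
  refine le_antisymm (semiTopSlowEntropy_expScale_le hf hK hKμ) ?_
  rw [← metricSlowEntropy_expScale hf, EReal.coe_ennreal_le_coe_ennreal_iff]
  exact iSup_le fun k => iSup₂_le fun P hP =>
    metricSlowEntropyOf_le_semiTopSlowEntropy expScale hf.toMeasurePreserving hP

end SemiTopological

end SlowEntropy

theorem mainTheorem6 {X : Type*} [MetricSpace X] [Nonempty X] [MeasurableSpace X] [BorelSpace X]
    (f : X → X) :
    (∀ (μ : Measure X) [IsProbabilityMeasure μ], Ergodic f μ →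
      (SlowEntropy.metricSlowEntropy SlowEntropy.expScale μ f : EReal)
          = SlowEntropy.ksEntropy μ f ∧
      ((∃ K : Set X, TotallyBounded K ∧ μ Kᶜ = 0) →
        (SlowEntropy.semiTopSlowEntropy SlowEntropy.expScale μ f : EReal)
          = SlowEntropy.ksEntropy μ f)) ∧
    (SlowEntropy.topSlowEntropy SlowEntropy.expScale f : EReal) = SlowEntropy.topEntropy f :=
  ⟨fun _ _ hf => ⟨SlowEntropy.metricSlowEntropy_expScale hf, fun ⟨_, hK, hKμ⟩ =>
    SlowEntropy.semiTopSlowEntropy_expScale hf hK hKμ⟩, SlowEntropy.topSlowEntropy_expScale f⟩
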